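/- **Theorem 4.2 (consistency of the MMD minimum-distance summary posterior).** Let $\mathcal X$ be a locally compact, second countable, metrizable space (e.g. $\mathbb R^{d}$), $\Theta$ a separable metrizable space (e.g. a subset of $\mathbb R^{p}$), both with their Borel $\sigma$-algebras, and $\mathcal S$ a measurable space. Let $k:\mathcal X\times\mathcal X\to\mathbb R$ be the reproducing kernel of a real reproducing kernel Hilbert space $\mathcal H$, with mean embedding $\mu_{P}=\int k(x,\cdot)\,dP(x)\in\mathcal H$ and $\mathrm{MMD}(P,Q)=\|\mu_P-\mu_Q\|_{\mathcal H}$. Let $(\mathbb P_\theta)_{\theta\in\Theta}$ be a family of probability measures on $\mathcal X$, $\pi$ a prior probability measure on $\Theta$, $\theta_0\in\Theta$, and $f_N:\mathcal X^N\to\mathcal S$ measurable for every $N$. Assume: 1. $k$ is bounded, continuous, vanishes at infinity in the sense that $k(x,\cdot)\in C_0(\mathcal X)$ for every $x\in\mathcal X$ (automatic if $\mathcal X$ is compact), and is integrally strictly positive definite: $\iint k(x,y)\,d\sigma(x)\,d\sigma(y)>0$ for every nonzero finite signed Borel measure $\sigma$ on $\mathcal X$. 2. There are a probability space $(\mathcal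 U,\mathcal F,\mathbb U)$ and measurable maps $G_\theta:\mathcal U\to\mathcal X$ with $\mathbb P_\theta=(G_\theta)_{\#}\mathbb U$ for every $\theta\in\Theta$. 3. For every $u\in\mathcal U$, the map $\theta\mapsto G_\theta(u)$ is continuous. 4. (Mixture identifiability.) For every sequence $(\mathbb T_N)$ of probability measures on $\Theta$, if the mixtures $\int\mathbb P_\theta(\cdot)\,d\mathbb T_N(\theta)$ converge weakly to $\mathbb P_{\theta_0}$, then $\mathbb T_N$ converges weakly to $\delta_{\theta_0}$. Consider the Bayesian model $\theta\sim\pi$ and $x_0,x_1,x_2,\dots\mid\theta$ i.i.d. with distribution $\mathbb P_\theta$. For each $N$ let $\mathbb P^N_{\theta\mid s}$, $s\in\mathcal S$, be a regular conditional distribution (any fixed version) of $\theta$ given $f_N(x_1,\dots,x_N)=s$, and let $\mathbb P^N_{x_0\mid s}=\int\mathbb P_\theta(\cdot)\,\mathbb P^N_{\theta\mid s}(d\theta)$ be the corresponding conditional distribution of the test variable $x_0$. For data $x_1,\dots,x_N$ write $s_N=f_N(x_1,\dots,x_N)$, $\hat{\mathbb P}_N=\frac1N\sum_{i=1}^N\delta_{x_i}$,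 and call $s^*_N\in\mathcal S$ a minimum-distance summary if $$\mathrm{MMD}\big(\mathbb P^N_{x_0\mid s^*_N},\hat{\mathbb P}_N\big)=\min_{s\in\mathcal S}\mathrm{MMD}\big(\mathbb P^N_{x_0\mid s},\hat{\mathbb P}_N\big).$$ Suppose that the model is correctly specified with true parameter $\theta_0$, i.e. the data $x_1,x_2,\dots$ are i.i.d. with distribution $\mathbb P_{\theta_0}$, and that, for almost every data sequence, $\mathbb P^N_{\theta\mid s_N}$ converges weakly to $\delta_{\theta_0}$ as $N\to\infty$. Then, for almost every data sequence and for every choice of minimum-distance summaries $s_N^*$, $N\ge 1$, of that sequence (assumed to exist), $\mathbb P^N_{\theta\mid s^*_N}$ converges weakly to $\delta_{\theta_0}$ as $N\to\infty$. -/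

import Mathlib

open MeasureTheory ProbabilityTheory Filter Topology
open scoped ENNReal

noncomputable section

namespace MinDistSummary

/-! ### Kernels and maximum mean discrepancy -/

section Kernel

variable {X : Type*} (H : Type*) [NormedAddCommGroup H] [InnerProductSpace ℝ H] [CompleteSpace H]
  [RKHS ℝ H X ℝ]

/-- The canonical feature map `φ x = k(x, ·)` of a real reproducing kernel Hilbert space. -/
def feature (x : X) : H := RKHS.kerFun H x (1 : ℝ)

/-- The reproducing kernel `k(x, y)`, a positive definite function `X × X → ℝ`. -/
def ker (x y : X) : ℝ := RKHS.kernel H x y (1 : ℝ)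

theorem ker_eq_inner (x y : X) : ker H x y = inner ℝ (feature H x) (feature H y) := by
  rw [feature, RKHS.kerFun_inner, feature, RKHS.kerFun_apply]; simp [ker]

/-- The kernel mean embedding `μ_P = 𝔼_{x ∼ P} φ(x)`. -/
def meanEmbedding [MeasurableSpace X] (P : Measure X) : H := ∫ x, feature H x ∂P

/-- The maximum mean discrepancy `‖μ_P - μ_Q‖_H`. -/
def mmd [MeasurableSpace X] (P Q : Measure X) : ℝ := ‖meanEmbedding H P - meanEmbedding H Q‖

/-- `k` is integrally strictly positive definite: `∬ k(x, y) dσ(x) dσ(y) > 0` for every nonzero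
finite signed Borel measure `σ`. -/
def IntegrallyStrictlyPosDef [MeasurableSpace X] (k : X → X → ℝ) : Prop :=
  ∀ σ : SignedMeasure X, σ ≠ 0 → 0 < ∫ᵛ x, (∫ᵛ y, k x y ∂<•σ) ∂<•σ

/-- The empirical distribution `N⁻¹ ∑ δ_{z i}` of `N` data points. -/
def empirical [MeasurableSpace X] {N : ℕ} (z : Fin N → X) : Measure X :=
  (N : ℝ≥0∞)⁻¹ • ∑ i, Measure.dirac (z i)

end Kernel

/-! ### The Bayesian model -/

section Model

variable {Θ X S : Type*} [MeasurableSpace Θ] [MeasurableSpace X] [MeasurableSpace S]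

/-- Given `θ`, an i.i.d. sequence `x₀, x₁, x₂, …` with distribution `P θ`. -/
def iidKernel (P : ProbabilityTheory.Kernel Θ X) [IsMarkovKernel P] :
    ProbabilityTheory.Kernel Θ (ℕ → X) where
  toFun θ := Measure.infinitePi (fun _ : ℕ => P θ)
  measurable' := by
    refine Measurable.measure_of_isPiSystem_of_isProbabilityMeasure
      (generateFrom_squareCylinders (α := fun _ : ℕ => X)).symm
      (isPiSystem_squareCylinders (fun _ => MeasurableSpace.isPiSystem_measurableSet)
        (fun _ => MeasurableSet.univ)) ?_
    rintro _ ⟨s, t, ht, rfl⟩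
    have ht' : ∀ i, MeasurableSet (t i) := fun i => ht i (Set.mem_univ i)
    have h : ∀ θ, Measure.infinitePi (fun _ : ℕ => P θ) ((s : Set ℕ).pi t) = ∏ i ∈ s, P θ (t i) :=
      fun θ => Measure.infinitePi_pi _ (fun i _ => ht' i)
    simp_rw [h]
    exact Finset.measurable_prod _ (fun i _ => P.measurable_coe (ht' i))

instance (P : ProbabilityTheory.Kernel Θ X) [IsMarkovKernel P] : IsMarkovKernel (iidKernel P) :=
  ⟨fun θ => inferInstanceAs (IsProbabilityMeasure (Measure.infinitePi (fun _ : ℕ => P θ)))⟩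

/-- The joint law of `(θ, (x₀, x₁, x₂, …))` when `θ ∼ π` and `xᵢ | θ ∼ P θ` independently. -/
def bayesModel (π : Measure Θ) (P : ProbabilityTheory.Kernel Θ X) [IsMarkovKernel P] :
    Measure (Θ × (ℕ → X)) := π ⊗ₘ iidKernel P

/-- The observed data `x₁, …, x_N`; the coordinate `x₀` is kept as a separate test variable. -/
def observed (N : ℕ) (x : ℕ → X) : Fin N → X := fun i => x (i + 1)

/-- `post N` is (a version of) the summary posterior, i.e. a regular conditional distribution of
`θ` given `s_N = f_N(x₁, …, x_N)` in the Bayesian model, for every sample size `N`. -/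
def IsSummaryPosterior (π : Measure Θ) (P : ProbabilityTheory.Kernel Θ X) [IsMarkovKernel P]
    (f : (N : ℕ) → (Fin N → X) → S) (post : ℕ → ProbabilityTheory.Kernel S Θ) : Prop :=
  ∀ N, HasCondDistrib (fun ω : Θ × (ℕ → X) => ω.1) (fun ω => f N (observed N ω.2)) (post N)
    (bayesModel π P)

/-- The predictive decoder: the conditional distribution of the test variable `x₀` given the
summary. As `x₀` is independent of `x₁, …, x_N` given `θ`, it is the mixture
`s ↦ ∫ P_θ(·) post(s, dθ)`; see `hasCondDistrib_decoder`. -/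
def decoder (P : ProbabilityTheory.Kernel Θ X) (post : ProbabilityTheory.Kernel S Θ) :
    ProbabilityTheory.Kernel S X := P ∘ₖ post

/-- The set of minimisers over all of `S` of `s ↦ MMD(P_{x₀|s}, P̂_N)`, where `P̂_N` is the
empirical distribution of the data `z`: the minimum-distance summaries. -/
def minimumDistanceSummaries (H : Type*) [NormedAddCommGroup H] [InnerProductSpace ℝ H]
    [CompleteSpace H] [RKHS ℝ H X ℝ] (P : ProbabilityTheory.Kernel Θ X)
    (post : ProbabilityTheory.Kernel S Θ) {N : ℕ} (z : Fin N → X) : Set S :=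
  {s | ∀ t : S, mmd H (decoder P post s) (empirical z) ≤ mmd H (decoder P post t) (empirical z)}

end Model

section Bundled

variable {Y Z : Type*} [MeasurableSpace Y] [MeasurableSpace Z]

/-- The value of a Markov kernel at a point, as an element of the space of probability measures
(which carries the topology of weak convergence). -/
def kernelAt (κ : ProbabilityTheory.Kernel Y Z) [IsMarkovKernel κ] (y : Y) :
    ProbabilityMeasure Z := ⟨κ y, inferInstance⟩

/-- The mixture `∫ κ(y, ·) dT(y)` as a probability measure. -/
def mixture (κ : ProbabilityTheory.Kernel Y Z) [IsMarkovKernel κ] (T : ProbabilityMeasure Y) :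
    ProbabilityMeasure Z := ⟨κ ∘ₘ (T : Measure Y), inferInstance⟩

/-- The point mass at `y`. -/
def pointMass (y : Y) : ProbabilityMeasure Y := ⟨Measure.dirac y, inferInstance⟩

end Bundled

section Decoder

variable {Θ X S : Type*} [MeasurableSpace Θ] [MeasurableSpace X] [MeasurableSpace S]

theorem measurable_observed (N : ℕ) : Measurable (observed N : (ℕ → X) → Fin N → X) := by
  unfold observed; fun_prop

theorem infinitePi_observed_inter (Q : Measure X) [IsProbabilityMeasure Q] (N : ℕ)
    {A : Set (Fin N → X)} (hA : MeasurableSet A) {B : Set X} (hB : MeasurableSet B) :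
    Measure.infinitePi (fun _ : ℕ => Q) (observed N ⁻¹' A ∩ (fun x => x 0) ⁻¹' B)
      = Measure.infinitePi (fun _ : ℕ => Q) (observed N ⁻¹' A) * Q B := by
  have hind : iIndepFun (fun (i : ℕ) (ω : ℕ → X) => ω i) (Measure.infinitePi (fun _ : ℕ => Q)) :=
    iIndepFun_infinitePi (X := fun _ x => x) (fun _ => measurable_id)
  have h1 := hind.indepFun_finset (Finset.Icc 1 N) {0} (by simp) (fun i => measurable_pi_apply i)
  have hφ : Measurable (fun (g : (Finset.Icc 1 N : Finset ℕ) → X) (i : Fin N) =>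
      g ⟨i + 1, by simp⟩) := by fun_prop
  have hψ : Measurable (fun g : ({0} : Finset ℕ) → X => g ⟨0, by simp⟩) :=
    measurable_pi_apply (X := fun _ : ({0} : Finset ℕ) => X) _
  have h2 := h1.comp hφ hψ
  have h3 := h2.measure_inter_preimage_eq_mul A B hA hB
  have h4 : Measure.infinitePi (fun _ : ℕ => Q) ((fun x => x 0) ⁻¹' B) = Q B := by
    rw [← Measure.map_apply (measurable_pi_apply 0) hB, Measure.infinitePi_map_eval]
  rw [← h4]
  exact h3

/-- The decoder is a regular conditional distribution of the test variable `x₀` given `s_N`. -/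
theorem hasCondDistrib_decoder (π : Measure Θ) [IsProbabilityMeasure π]
    (P : ProbabilityTheory.Kernel Θ X) [IsMarkovKernel P]
    (f : (N : ℕ) → (Fin N → X) → S) (hf : ∀ N, Measurable (f N))
    (post : ℕ → ProbabilityTheory.Kernel S Θ) [∀ N, IsMarkovKernel (post N)]
    (hpost : IsSummaryPosterior π P f post) (N : ℕ) :
    HasCondDistrib (fun ω : Θ × (ℕ → X) => ω.2 0) (fun ω => f N (observed N ω.2))
      (decoder P (post N)) (bayesModel π P) := by
  have hobs := measurable_observed (X := X) N
  have hs : Measurable (fun ω : Θ × (ℕ → X) => f N (observed N ω.2)) :=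
    (hf N).comp (hobs.comp measurable_snd)
  have hx : Measurable (fun ω : Θ × (ℕ → X) => ω.2 0) := by fun_prop
  have : IsProbabilityMeasure (bayesModel π P) := by unfold bayesModel; infer_instance
  have : IsMarkovKernel (decoder P (post N)) := by unfold decoder; infer_instance
  have : IsProbabilityMeasure ((bayesModel π P).map (fun ω => f N (observed N ω.2))) :=
    Measure.isProbabilityMeasure_map hs.aemeasurable
  refine ⟨by fun_prop, Measure.ext_prod fun {A B} hA hB => ?_⟩
  have hA' : MeasurableSet (f N ⁻¹' A) := hf N hA
  have hsA : MeasurableSet (observed N ⁻¹' (f N ⁻¹' A)) := hobs hA'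
  have hPB : Measurable (fun θ => P θ B) := P.measurable_coe hB
  have hpm := (hpost N).map_eq
  have e1 : (bayesModel π P).map (fun ω => (f N (observed N ω.2), ω.2 0)) (A ×ˢ B)
      = ∫⁻ θ, iidKernel P θ (observed N ⁻¹' (f N ⁻¹' A)) * P θ B ∂π := by
    rw [Measure.map_apply (by fun_prop) (hA.prod hB), bayesModel,
      Measure.compProd_apply ((hs.prodMk hx) (hA.prod hB))]
    exact lintegral_congr fun θ => infinitePi_observed_inter (P θ) N hA' hB
  have e2 : ((bayesModel π P).map (fun ω => f N (observed N ω.2)) ⊗ₘ decoder P (post N)) (A ×ˢ B)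
      = ∫⁻ p, A.indicator 1 p.1 * P p.2 B
        ∂((bayesModel π P).map (fun ω => f N (observed N ω.2)) ⊗ₘ post N) := by
    have hm : Measurable (fun p : S × Θ => A.indicator (1 : S → ℝ≥0∞) p.1 * P p.2 B) :=
      ((measurable_one.indicator hA).comp measurable_fst).mul (hPB.comp measurable_snd)
    rw [Measure.lintegral_compProd hm, Measure.compProd_apply_prod hA hB,
      ← lintegral_indicator hA]
    refine lintegral_congr fun s => ?_
    by_cases h : s ∈ A
    · simp [h, decoder, Kernel.comp_apply' _ _ _ hB]
    · simp [h]
  have e3 : ∫⁻ p, A.indicator 1 p.1 * P p.2 B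
        ∂((bayesModel π P).map (fun ω => f N (observed N ω.2)) ⊗ₘ post N)
      = ∫⁻ θ, iidKernel P θ (observed N ⁻¹' (f N ⁻¹' A)) * P θ B ∂π := by
    have hm : Measurable (fun p : S × Θ => A.indicator (1 : S → ℝ≥0∞) p.1 * P p.2 B) :=
      ((measurable_one.indicator hA).comp measurable_fst).mul (hPB.comp measurable_snd)
    rw [← hpm, lintegral_map hm (hs.prodMk measurable_fst), bayesModel]
    refine (Measure.lintegral_compProd (hm.comp (hs.prodMk measurable_fst))).trans ?_
    refine lintegral_congr fun θ => ?_
    refine (lintegral_mul_const (P θ B) ((measurable_one.indicator hA).comp ((hf N).comp hobs))).trans ?_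
    congr 1
    rw [← lintegral_indicator_one hsA]
    rfl
  rw [e1, e2, e3]

end Decoder

end MinDistSummary

end

open MinDistSummary

open scoped BoundedContinuousFunction

namespace MinDistSummary

/-! ### The feature map -/

section Feature

variable {X : Type*} {H : Type*} [NormedAddCommGroup H] [InnerProductSpace ℝ H] [CompleteSpace H]
  [RKHS ℝ H X ℝ]

/-! Minimality of `sStar N` against the single competitor `f N (observed N x)`, with two triangle
inequalities, bounds the MMD from the decoder at `sStar N` to `P θ₀` by that at the original summary
plus twice the MMD between `P θ₀` and the empirical law. The last term vanishes by the strong law in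
`H` (`tendsto_mmd_empirical`), the other because `θ ↦ meanEmbedding H (P θ)` is bounded and
continuous (`tendsto_mmd_mixture`). By `tendsto_of_tendsto_mmd` the decoders converge weakly, and
identifiability carries this to the posteriors.

MMD convergence gives weak convergence without assuming tightness: vague limits exist along
ultrafilters, kernel sections lie in `C₀` and so pass to the limit, and strict positive definiteness
forces the limit to be the target, so no mass escapes. -/

theorem norm_feature_le {C : ℝ} (hC : ∀ x y : X, |ker H x y| ≤ C) (x : X) :
    ‖feature H x‖ ≤ √C := by
  refine Real.le_sqrt_of_sq_le ?_
  rw [← real_inner_self_eq_norm_sq, ← ker_eq_inner]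
  exact (le_abs_self _).trans (hC x x)

theorem continuous_diagonal_and_sections [TopologicalSpace X] {k : X → X → ℝ}
    (hk : Continuous fun p : X × X => k p.1 p.2) :
    (Continuous fun x => k x x) ∧ (∀ x, Continuous fun y => k x y) ∧
      ∀ y, Continuous fun x => k x y :=
  ⟨hk.comp (continuous_id.prodMk continuous_id),
    fun _ => hk.comp (continuous_const.prodMk continuous_id),
    fun _ => hk.comp (continuous_id.prodMk continuous_const)⟩

/-- The squared distance between two features is a combination of kernel values. -/
theorem continuous_feature [TopologicalSpace X]
    (hk : Continuous fun p : X × X => ker H p.1 p.2) : Continuous (feature H : X → H) := by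
  refine continuous_iff_continuousAt.2 fun x => tendsto_iff_norm_sub_tendsto_zero.2 ?_
  have hexp : ∀ y, ‖feature H y - feature H x‖ ^ 2
      = ker H y y - 2 * ker H y x + ker H x x := fun y => by
    rw [norm_sub_sq_real, ker_eq_inner, ker_eq_inner, ker_eq_inner, real_inner_self_eq_norm_sq,
      real_inner_self_eq_norm_sq]
  have hcont : Continuous fun y => √(ker H y y - 2 * ker H y x + ker H x x) := by
    have hsec := continuous_diagonal_and_sections hk
    exact ((hsec.1.sub (continuous_const.mul (hsec.2.2 x))).add continuous_const).sqrt
  have hlim := hcont.tendsto x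
  have h0 : ker H x x - 2 * ker H x x + ker H x x = 0 := by ring
  rw [h0, Real.sqrt_zero] at hlim
  refine hlim.congr fun y => ?_
  rw [← hexp, Real.sqrt_sq (norm_nonneg _)]

variable [TopologicalSpace X] [TopologicalSpace.MetrizableSpace X] [SecondCountableTopology X]
  [MeasurableSpace X] [BorelSpace X]

/-- Second countability of `X` makes the feature map strongly measurable, so `H` need not be
separable. -/
theorem integrable_feature (hk_bdd : ∃ C : ℝ, ∀ x y : X, |ker H x y| ≤ C)
    (hk : Continuous fun p : X × X => ker H p.1 p.2) (Q : Measure X) [IsFiniteMeasure Q] :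
    Integrable (feature H) Q := by
  obtain ⟨C, hC⟩ := hk_bdd
  let _ := TopologicalSpace.metrizableSpaceMetric X
  exact Integrable.of_bound (continuous_feature hk).stronglyMeasurable.aestronglyMeasurable (√C)
    (ae_of_all _ (norm_feature_le hC))

/-- Turns norm convergence of embeddings into convergence of integrals of kernel sections. -/
theorem inner_feature_meanEmbedding (hk_bdd : ∃ C : ℝ, ∀ x y : X, |ker H x y| ≤ C)
    (hk : Continuous fun p : X × X => ker H p.1 p.2) (Q : Measure X) [IsFiniteMeasure Q] (x : X) :
    inner ℝ (feature H x) (meanEmbedding H Q) = ∫ y, ker H x y ∂Q := by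
  simp_rw [meanEmbedding, ker_eq_inner]
  exact (integral_inner (integrable_feature hk_bdd hk Q) _).symm

theorem integrable_ker (hk_bdd : ∃ C : ℝ, ∀ x y : X, |ker H x y| ≤ C)
    (hk : Continuous fun p : X × X => ker H p.1 p.2) (Q : Measure X) [IsFiniteMeasure Q] (x : X) :
    Integrable (fun y => ker H x y) Q := by
  simp_rw [ker_eq_inner]
  exact (integrable_feature hk_bdd hk Q).const_inner _

/-- A kernel which is integrally strictly positive definite is characteristic: a finite measure is
determined by the integrals of the kernel sections. -/
theorem IntegrallyStrictlyPosDef.measure_eq (hk_bdd : ∃ C : ℝ, ∀ x y : X, |ker H x y| ≤ C)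
    (hk : Continuous fun p : X × X => ker H p.1 p.2)
    (hk_ispd : IntegrallyStrictlyPosDef (ker H : X → X → ℝ)) {Q Q' : Measure X}
    [IsFiniteMeasure Q] [IsFiniteMeasure Q'] (h : ∀ x, ∫ y, ker H x y ∂Q = ∫ y, ker H x y ∂Q') :
    Q = Q' := by
  rw [← Measure.toSignedMeasure_eq_toSignedMeasure_iff, ← sub_eq_zero]
  by_contra hne
  have hpos := hk_ispd _ hne
  have hzero : ∀ x, ∫ᵛ y, ker H x y ∂<•(Q.toSignedMeasure - Q'.toSignedMeasure) = 0 := fun x => by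
    rw [VectorMeasure.integral_sub_vectorMeasure, VectorMeasure.integral_toSignedMeasure,
      VectorMeasure.integral_toSignedMeasure, h, sub_self]
    · simpa [VectorMeasure.Integrable] using integrable_ker hk_bdd hk Q x
    · simpa [VectorMeasure.Integrable] using integrable_ker hk_bdd hk Q' x
  simp_rw [hzero] at hpos
  exact hpos.ne' (VectorMeasure.integral_zero (E := ℝ))

/-- Strong law of large numbers for the mean embedding of the empirical distribution. -/
theorem tendsto_mmd_empirical (hk_bdd : ∃ C : ℝ, ∀ x y : X, |ker H x y| ≤ C)
    (hk : Continuous fun p : X × X => ker H p.1 p.2) (Q : Measure X) [IsProbabilityMeasure Q] :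
    ∀ᵐ x ∂(Measure.infinitePi fun _ : ℕ => Q),
      Tendsto (fun N => mmd H Q (empirical (observed N x))) atTop (𝓝 0) := by
  borelize H
  have hφ : Measurable (feature H : X → H) := (continuous_feature hk).measurable
  have hind : iIndepFun (fun (i : ℕ) (ω : ℕ → X) => feature H (ω i))
      (Measure.infinitePi fun _ : ℕ => Q) :=
    iIndepFun_infinitePi (X := fun _ => feature H) fun _ => hφ
  have hlaw : ∀ i : ℕ, (Measure.infinitePi fun _ : ℕ => Q).map (fun ω => ω i) = Q :=
    fun i => Measure.infinitePi_map_eval _ i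
  have hint := integrable_feature hk_bdd hk Q
  -- Data start at index 1, so the reference variable of the strong law is the one at `0 + 1`.
  have hint1 : Integrable (fun ω : ℕ → X => feature H (ω (0 + 1)))
      (Measure.infinitePi fun _ : ℕ => Q) := by
    have h1 : Integrable (feature H) ((Measure.infinitePi fun _ : ℕ => Q).map (fun ω => ω (0 + 1))) := by
      rwa [hlaw]
    exact h1.comp_measurable (measurable_pi_apply _)
  have hmean : ∫ ω : ℕ → X, feature H (ω (0 + 1)) ∂(Measure.infinitePi fun _ : ℕ => Q)
      = meanEmbedding H Q := by
    rw [meanEmbedding]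
    conv_rhs => rw [← hlaw (0 + 1)]
    rw [integral_map (measurable_pi_apply _).aemeasurable]
    rw [hlaw]
    exact hint.aestronglyMeasurable
  have hslln := strong_law_ae (μ := Measure.infinitePi fun _ : ℕ => Q)
    (fun (i : ℕ) (ω : ℕ → X) => feature H (ω (i + 1))) hint1
    (fun i j hij => hind.indepFun (by simpa using hij))
    (fun i => by
      refine ⟨(hφ.comp (measurable_pi_apply _)).aemeasurable,
        (hφ.comp (measurable_pi_apply _)).aemeasurable, ?_⟩
      have hm : ∀ j : ℕ, (Measure.infinitePi fun _ : ℕ => Q).map (fun ω => feature H (ω j))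
          = Q.map (feature H) := fun j => by
        conv_rhs => rw [← hlaw j]
        exact (Measure.map_map hφ (measurable_pi_apply j)).symm
      rw [hm, hm])
  rw [hmean] at hslln
  filter_upwards [hslln] with x hx
  -- For `N = 0` both sides are zero.
  have hemp : ∀ N, meanEmbedding H (empirical (observed N x))
      = (N : ℝ)⁻¹ • ∑ i ∈ Finset.range N, feature H (x (i + 1)) := fun N => by
    rw [meanEmbedding, empirical, integral_smul_measure,
      integral_finsetSum_measure fun i _ => integrable_feature hk_bdd hk _]
    simp [observed, Finset.sum_range]
  have hlim := tendsto_iff_norm_sub_tendsto_zero.1 hx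
  refine hlim.congr fun N => ?_
  rw [mmd, hemp, norm_sub_rev]

/-! ### The maximum mean discrepancy metrizes weak convergence -/

/-- A continuous function vanishing at infinity, extended by zero to the one-point
compactification. -/
def extendZero (g : X → ℝ) (hg : Continuous g) (hg0 : Tendsto g (cocompact X) (𝓝 0)) :
    OnePoint X →ᵇ ℝ :=
  BoundedContinuousFunction.mkOfCompact
    { toFun := fun z => z.elim 0 g
      continuous_toFun := by
        refine continuous_iff_continuousAt.2 fun z => ?_
        induction z using OnePoint.rec with
        | infty =>
          rw [OnePoint.continuousAt_infty', coclosedCompact_eq_cocompact]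
          exact hg0
        | coe x => exact OnePoint.continuousAt_coe.2 hg.continuousAt }

variable [LocallyCompactSpace X]

/-- Every ultrafilter of probability measures converges vaguely to a finite measure. -/
theorem exists_vague_limit {ι : Type*} (L : Ultrafilter ι) (Q : ι → ProbabilityMeasure X) :
    ∃ M : Measure X, IsFiniteMeasure M ∧ ∀ g : X → ℝ, Continuous g →
      Tendsto g (cocompact X) (𝓝 0) →
        Tendsto (fun i => ∫ x, g x ∂(Q i : Measure X)) L (𝓝 (∫ x, g x ∂M)) := by
  borelize (OnePoint X)
  have hemb : MeasurableEmbedding (OnePoint.some : X → OnePoint X) :=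
    OnePoint.isOpenEmbedding_coe.measurableEmbedding
  have hsome : Continuous (OnePoint.some : X → OnePoint X) := OnePoint.continuous_coe
  let Q' : ι → ProbabilityMeasure (OnePoint X) := fun i =>
    (Q i).map hsome.measurable.aemeasurable
  -- Probability measures on the compactification form a compact space; `M` may charge the added
  -- point, so its restriction to `X` may lose mass.
  obtain ⟨M, -, hM⟩ := isCompact_univ.ultrafilter_le_nhds (L.map Q') (by simp)
  have hM' : Tendsto Q' L (𝓝 M) := hM
  refine ⟨(M : Measure (OnePoint X)).comap OnePoint.some, ?_, fun g hg hg0 => ?_⟩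
  · refine ⟨?_⟩
    rw [hemb.comap_apply]
    exact measure_lt_top _ _
  have hlim := ProbabilityMeasure.tendsto_iff_forall_integral_tendsto.1 hM' (extendZero g hg hg0)
  have h1 : ∀ i, ∫ z, extendZero g hg hg0 z ∂(Q' i : Measure (OnePoint X))
      = ∫ x, g x ∂(Q i : Measure X) := fun i => hemb.integral_map _
  have h2 : ∫ z, extendZero g hg hg0 z ∂(M : Measure (OnePoint X))
      = ∫ x, g x ∂((M : Measure (OnePoint X)).comap OnePoint.some) := by
    have h3 := hemb.integral_map (μ := (M : Measure (OnePoint X)).comap OnePoint.some) (extendZero g hg hg0)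
    rw [hemb.map_comap] at h3
    -- Mass at infinity is invisible to a function that is zero there.
    rw [setIntegral_eq_integral_of_forall_compl_eq_zero] at h3
    · exact h3
    · intro z hz
      induction z using OnePoint.rec with
      | infty => rfl
      | coe x => exact absurd (Set.mem_range_self x) hz
  rw [h2] at hlim
  exact hlim.congr h1

/-- Vague convergence of probability measures to a probability measure is weak convergence. -/
theorem tendsto_of_forall_hasCompactSupport {Q : ℕ → ProbabilityMeasure X}
    {R : ProbabilityMeasure X}
    (h : ∀ g : X → ℝ, Continuous g → HasCompactSupport g →
      Tendsto (fun n => ∫ x, g x ∂(Q n : Measure X)) atTop (𝓝 (∫ x, g x ∂(R : Measure X)))) :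
    Tendsto Q atTop (𝓝 R) := by
  let _ := TopologicalSpace.metrizableSpaceMetric X
  -- Portmanteau on open sets: inner regularity reduces `G` to a compact `K`, and a Urysohn function
  -- fits between their indicators.
  refine tendsto_of_forall_isOpen_le_liminf_nat' fun G hG => ?_
  rw [hG.measure_eq_iSup_isCompact]
  refine iSup₂_le fun K hKG => iSup_le fun hK => ?_
  obtain ⟨g, hg1, hg0, hgc, hg⟩ := exists_continuous_one_zero_of_isCompact hK hG.isClosed_compl
    (Set.disjoint_compl_right_iff_subset.2 hKG)
  have hint : ∀ T : ProbabilityMeasure X, Integrable g (T : Measure X) := fun T =>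
    g.continuous.integrable_of_hasCompactSupport hgc
  have hle : ∀ T : ProbabilityMeasure X,
      ENNReal.ofReal (∫ x, g x ∂(T : Measure X)) ≤ (T : Measure X) G := fun T => by
    rw [ofReal_integral_eq_lintegral_ofReal (hint T) (ae_of_all _ fun x => (hg x).1),
      ← lintegral_indicator_one hG.measurableSet]
    refine lintegral_mono fun x => ?_
    by_cases hx : x ∈ G
    · simpa [hx] using (hg x).2
    · simp [hx, hg0 (show x ∈ Gᶜ from hx)]
  have hge : (R : Measure X) K ≤ ENNReal.ofReal (∫ x, g x ∂(R : Measure X)) := by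
    rw [ofReal_integral_eq_lintegral_ofReal (hint R) (ae_of_all _ fun x => (hg x).1),
      ← lintegral_indicator_one hK.measurableSet]
    refine lintegral_mono fun x => ?_
    by_cases hx : x ∈ K
    · simp [hx, hg1 hx]
    · simp [hx]
  have hlim := (ENNReal.continuous_ofReal.tendsto _).comp (h g g.continuous hgc)
  calc (R : Measure X) K ≤ ENNReal.ofReal (∫ x, g x ∂(R : Measure X)) := hge
    _ = liminf (fun n => ENNReal.ofReal (∫ x, g x ∂(Q n : Measure X))) atTop :=
        hlim.liminf_eq.symm
    _ ≤ _ := liminf_le_liminf (Eventually.of_forall fun n => hle (Q n))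

/-- Convergence in maximum mean discrepancy implies weak convergence. -/
theorem tendsto_of_tendsto_mmd (hk_bdd : ∃ C : ℝ, ∀ x y : X, |ker H x y| ≤ C)
    (hk : Continuous fun p : X × X => ker H p.1 p.2)
    (hk_zero : ∀ x : X, Tendsto (fun y => ker H x y) (cocompact X) (𝓝 0))
    (hk_ispd : IntegrallyStrictlyPosDef (ker H : X → X → ℝ))
    {Q : ℕ → ProbabilityMeasure X} {R : ProbabilityMeasure X}
    (h : Tendsto (fun n => mmd H (Q n : Measure X) (R : Measure X)) atTop (𝓝 0)) :
    Tendsto Q atTop (𝓝 R) := by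
  refine tendsto_of_forall_hasCompactSupport fun g hg hgc => ?_
  rw [tendsto_iff_ultrafilter]
  intro L hL
  obtain ⟨M, hMfin, hM⟩ := exists_vague_limit L Q
  have hemb : Tendsto (fun n => meanEmbedding H (Q n : Measure X)) L
      (𝓝 (meanEmbedding H (R : Measure X))) :=
    (tendsto_iff_norm_sub_tendsto_zero.2 h).mono_left hL
  -- Both measures integrate every kernel section to the limit of the same sequence along `L`.
  have hMR : M = (R : Measure X) := by
    refine hk_ispd.measure_eq hk_bdd hk fun x => ?_
    refine tendsto_nhds_unique
      (hM _ ((continuous_diagonal_and_sections hk).2.1 x) (hk_zero x)) ?_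
    simp_rw [← inner_feature_meanEmbedding hk_bdd hk]
    exact tendsto_const_nhds.inner hemb
  rw [← hMR]
  exact hM g hg hgc.is_zero_at_infty

end Feature

/-! ### Consistency of the decoder -/

section Mixture

variable {X Θ U : Type*} [TopologicalSpace X] [TopologicalSpace.MetrizableSpace X]
  [SecondCountableTopology X] [MeasurableSpace X] [BorelSpace X]
  [TopologicalSpace Θ] [TopologicalSpace.MetrizableSpace Θ] [MeasurableSpace Θ] [BorelSpace Θ]
  [MeasurableSpace U] {H : Type*} [NormedAddCommGroup H] [InnerProductSpace ℝ H] [CompleteSpace H]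
  [RKHS ℝ H X ℝ]

/-- The mean embedding of a parametric family with a continuous generator is continuous. -/
theorem continuous_meanEmbedding (hk_bdd : ∃ C : ℝ, ∀ x y : X, |ker H x y| ≤ C)
    (hk : Continuous fun p : X × X => ker H p.1 p.2) (P : ProbabilityTheory.Kernel Θ X)
    (ν : Measure U) [IsProbabilityMeasure ν] (G : Θ → U → X) (hG_meas : ∀ θ, Measurable (G θ))
    (hG_push : ∀ θ, P θ = ν.map (G θ)) (hG_cont : ∀ u, Continuous fun θ => G θ u) :
    Continuous fun θ => meanEmbedding H (P θ) := by
  obtain ⟨C, hC⟩ := hk_bdd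
  let _ := TopologicalSpace.metrizableSpaceMetric X
  let _ := TopologicalSpace.metrizableSpaceMetric Θ
  have hφ := continuous_feature hk
  have hrw : ∀ θ, meanEmbedding H (P θ) = ∫ u, feature H (G θ u) ∂ν := fun θ => by
    rw [meanEmbedding, hG_push, integral_map (hG_meas θ).aemeasurable
      hφ.stronglyMeasurable.aestronglyMeasurable]
  simp_rw [hrw]
  exact continuous_of_dominated
    (fun θ => (hφ.stronglyMeasurable.comp_measurable (hG_meas θ)).aestronglyMeasurable)
    (fun θ => ae_of_all _ fun u => norm_feature_le hC (G θ u)) (integrable_const (√C))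
    (ae_of_all _ fun u => hφ.comp (hG_cont u))

/-- The maximum mean discrepancy is convex: that of a mixture is at most the mean one. -/
theorem mmd_mixture_le (hk_bdd : ∃ C : ℝ, ∀ x y : X, |ker H x y| ≤ C)
    (hk : Continuous fun p : X × X => ker H p.1 p.2) (P : ProbabilityTheory.Kernel Θ X)
    [IsMarkovKernel P] (R : Measure X) (T : ProbabilityMeasure Θ)
    (hint : Integrable (fun θ => meanEmbedding H (P θ)) (T : Measure Θ)) :
    mmd H (mixture P T : Measure X) R ≤ ∫ θ, mmd H (P θ) R ∂(T : Measure Θ) := by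
  have hmix : meanEmbedding H (mixture P T : Measure X)
      = ∫ θ, meanEmbedding H (P θ) ∂(T : Measure Θ) :=
    Kernel.integral_comp (κ := Kernel.const Unit (T : Measure Θ)) (a := ())
      (integrable_feature hk_bdd hk (mixture P T : Measure X))
  have hsub : ∫ θ, (meanEmbedding H (P θ) - meanEmbedding H R) ∂(T : Measure Θ)
      = meanEmbedding H (mixture P T : Measure X) - meanEmbedding H R := by
    rw [integral_sub hint (integrable_const _), hmix]
    simp
  rw [mmd, ← hsub]
  exact norm_integral_le_integral_norm _

/-- The MMD to `P θ₀` is a bounded continuous function of `θ` that vanishes at `θ₀`; weak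
convergence is tested on it, and convexity bounds the mixture. -/
theorem tendsto_mmd_mixture (hk_bdd : ∃ C : ℝ, ∀ x y : X, |ker H x y| ≤ C)
    (hk : Continuous fun p : X × X => ker H p.1 p.2) (P : ProbabilityTheory.Kernel Θ X)
    [IsMarkovKernel P] [SecondCountableTopology Θ]
    (hP : Continuous fun θ => meanEmbedding H (P θ)) {θ₀ : Θ} {T : ℕ → ProbabilityMeasure Θ}
    (hT : Tendsto T atTop (𝓝 (pointMass θ₀))) :
    Tendsto (fun n => mmd H (mixture P (T n) : Measure X) (P θ₀)) atTop (𝓝 0) := by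
  let _ := TopologicalSpace.metrizableSpaceMetric Θ
  obtain ⟨C, hC⟩ := id hk_bdd
  have hbd : ∀ θ, ‖meanEmbedding H (P θ)‖ ≤ √C := fun θ => by
    have h := norm_integral_le_of_norm_le_const (μ := P θ) (ae_of_all _ (norm_feature_le hC))
    simpa [meanEmbedding] using h
  let F : Θ →ᵇ ℝ := BoundedContinuousFunction.ofNormedAddCommGroup (fun θ => mmd H (P θ) (P θ₀))
    (hP.sub continuous_const).norm (√C + √C) fun θ => by
      rw [mmd, norm_norm]
      exact (norm_sub_le _ _).trans (add_le_add (hbd θ) (hbd θ₀))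
  have hlim := ProbabilityMeasure.tendsto_iff_forall_integral_tendsto.1 hT F
  have h0 : ∫ θ, F θ ∂(pointMass θ₀ : Measure Θ) = 0 := by
    change ∫ θ, F θ ∂(Measure.dirac θ₀) = 0
    rw [integral_dirac]
    simp [F, mmd]
  rw [h0] at hlim
  refine squeeze_zero (fun n => norm_nonneg _) (fun n => ?_) hlim
  exact mmd_mixture_le hk_bdd hk P (P θ₀) (T n)
    (Integrable.of_bound hP.stronglyMeasurable.aestronglyMeasurable (√C) (ae_of_all _ hbd))

end Mixture

/-! ### Decoder as mixture, and pseudometric properties of the MMD -/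

section Decoder

variable {X Θ S : Type*} [MeasurableSpace X] [MeasurableSpace Θ] [MeasurableSpace S]

theorem mixture_kernelAt (P : ProbabilityTheory.Kernel Θ X) [IsMarkovKernel P]
    (post : ProbabilityTheory.Kernel S Θ) [IsMarkovKernel post] (s : S) :
    (mixture P (kernelAt post s) : Measure X) = decoder P post s := rfl

theorem mmd_triangle (H : Type*) [NormedAddCommGroup H] [InnerProductSpace ℝ H] [CompleteSpace H]
    [RKHS ℝ H X ℝ] (P Q R : Measure X) : mmd H P R ≤ mmd H P Q + mmd H Q R :=
  norm_sub_le_norm_sub_add_norm_sub _ _ _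

theorem mmd_comm (H : Type*) [NormedAddCommGroup H] [InnerProductSpace ℝ H] [CompleteSpace H]
    [RKHS ℝ H X ℝ] (P Q : Measure X) : mmd H P Q = mmd H Q P := norm_sub_rev _ _

end Decoder

end MinDistSummary

theorem theorem4p2
    -- data space, parameter space, space of summaries, noise space
    {X Θ S U : Type*}
    [TopologicalSpace X] [TopologicalSpace.MetrizableSpace X] [SecondCountableTopology X]
    [LocallyCompactSpace X] [MeasurableSpace X] [BorelSpace X]
    [TopologicalSpace Θ] [TopologicalSpace.MetrizableSpace Θ] [SecondCountableTopology Θ]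
    [MeasurableSpace Θ] [BorelSpace Θ]
    [MeasurableSpace S] [MeasurableSpace U]
    -- the reproducing kernel Hilbert space and its kernel
    {H : Type*} [NormedAddCommGroup H] [InnerProductSpace ℝ H] [CompleteSpace H] [RKHS ℝ H X ℝ]
    -- `k` is bounded, continuous, vanishing at infinity and integrally strictly positive definite
    (hk_bdd : ∃ C : ℝ, ∀ x y : X, |ker H x y| ≤ C)
    (hk_cont : Continuous fun p : X × X => ker H p.1 p.2)
    (hk_zero : ∀ x : X, Tendsto (fun y => ker H x y) (cocompact X) (𝓝 0))
    (hk_ispd : IntegrallyStrictlyPosDef (ker H : X → X → ℝ))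
    -- the parametric family, given by a generator that is continuous in the parameter
    (P : ProbabilityTheory.Kernel Θ X) [IsMarkovKernel P]
    (ν : Measure U) [IsProbabilityMeasure ν] (G : Θ → U → X)
    (hG_meas : ∀ θ, Measurable (G θ)) (hG_push : ∀ θ, P θ = ν.map (G θ))
    (hG_cont : ∀ u, Continuous fun θ => G θ u)
    -- the true parameter and mixture identifiability
    (θ₀ : Θ)
    (h_ident : ∀ T : ℕ → ProbabilityMeasure Θ,
      Tendsto (fun N => mixture P (T N)) atTop (𝓝 (kernelAt P θ₀)) →
        Tendsto T atTop (𝓝 (pointMass θ₀)))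
    -- prior, summary statistics, summary posteriors
    (π : Measure Θ) [IsProbabilityMeasure π]
    (f : (N : ℕ) → (Fin N → X) → S) (hf : ∀ N, Measurable (f N))
    (post : ℕ → ProbabilityTheory.Kernel S Θ) [∀ N, IsMarkovKernel (post N)]
    (h_post : IsSummaryPosterior π P f post)
    -- consistency of the posterior at the original summaries, for data drawn under `θ₀`
    (h_cons : ∀ᵐ x ∂(Measure.infinitePi fun _ : ℕ => P θ₀),
      Tendsto (fun N => kernelAt (post N) (f N (observed N x))) atTop (𝓝 (pointMass θ₀))) :
    ∀ᵐ x ∂(Measure.infinitePi fun _ : ℕ => P θ₀),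
      ∀ sStar : ℕ → S,
        (∀ N, 1 ≤ N → sStar N ∈ minimumDistanceSummaries H P (post N) (observed N x)) →
        Tendsto (fun N => kernelAt (post N) (sStar N)) atTop (𝓝 (pointMass θ₀)) := by
  filter_upwards [h_cons, tendsto_mmd_empirical (H := H) hk_bdd hk_cont (P θ₀)]
    with x hx hemp sStar hStar
  have hP := continuous_meanEmbedding hk_bdd hk_cont P ν G hG_meas hG_push hG_cont
  have hdec := tendsto_mmd_mixture (T := fun N => kernelAt (post N) (f N (observed N x)))
    hk_bdd hk_cont P hP hx
  simp only [mixture_kernelAt] at hdec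
  have hmin : Tendsto (fun N => mmd H (decoder P (post N) (sStar N)) (P θ₀)) atTop (𝓝 0) := by
    -- The empirical error enters twice: in leaving the empirical law for `P θ₀`, and in bounding
    -- the competitor's distance to the data.
    have hsum := (hdec.add hemp).add hemp
    rw [add_zero, add_zero] at hsum
    refine squeeze_zero' (Eventually.of_forall fun N => norm_nonneg _) ?_ hsum
    filter_upwards [eventually_ge_atTop 1] with N hN
    have h1 := mmd_triangle H (decoder P (post N) (sStar N)) (empirical (observed N x)) (P θ₀)
    have h2 := mmd_triangle H (decoder P (post N) (f N (observed N x))) (P θ₀)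
      (empirical (observed N x))
    have h3 := hStar N hN (f N (observed N x))
    rw [mmd_comm H (empirical (observed N x))] at h1
    linarith
  exact h_ident (fun N => kernelAt (post N) (sStar N))
    (tendsto_of_tendsto_mmd hk_bdd hk_cont hk_zero hk_ispd hmin)
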